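/- Let $R$ be a Noetherian commutative ring, let $J \subseteq R$ be an ideal, and let $\mathbf{w} = (w_1, w_2, \ldots)$ be an arbitrary sequence of positive integers. Put $0:J^\infty = \bigcup_{m \ge 0} (0 : J^m)$. For $s \ge 0$ regard $R[x_1,\ldots,x_s]$ as a graded ring with $\deg x_i = w_i$, and for a polynomial $f$ let $\mathrm{in}_{\mathbf{w}}(f)$ be the weighted homogeneous part of $f$ of least degree (with $\mathrm{in}_{\mathbf{w}}(0)=0$). A sequence $a_1,\ldots,a_s$ of elements of $R$ is called weighted independent with respect to $\mathbf{w}$ if, for every $f \in R[x_1,\ldots,x_s]$ with $f(a_1,\ldots,a_s)=0$, no coefficient of $\mathrm{in}_{\mathbf{w}}(f)$ is invertible in $R$ (the coefficients include the zero coefficients). If $0:J^\infty \ne R$, then the Krull dimension $$\dim R/(0:J^\infty)$$ is the supremum (possibly $\infty$) of the lengths $s$ of the sequences $a_1,\ldots,a_s \in J$ that are weighted independent with respect to $\mathbf{w}$, where the empty sequence, of length $0$, is included. If $0:J^\infty = R$ (that is, if $J$ is nilpotent, so that $R/(0:J^\infty)$ is the zero ring), then no sequence of positive length in $J$ is weighted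 independent with respect to $\mathbf{w}$. -/

import Mathlib

/-- The ideal `0 : J^∞ = ⋃ₘ (0 : J^m)`. The ideals `0 : J^m` increase with `m`, so their supremum
is their union, see `mem_zeroColonInfty`. -/
noncomputable def zeroColonInfty {R : Type*} [CommRing R] (J : Ideal R) : Ideal R :=
  ⨆ m : ℕ, (⊥ : Ideal R).colon ((J ^ m : Ideal R) : Set R)

theorem mem_zeroColonInfty {R : Type*} [CommRing R] {J : Ideal R} {x : R} :
    x ∈ zeroColonInfty J ↔ ∃ m : ℕ, ∀ y ∈ J ^ m, x * y = 0 := by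
  have hdir : Directed (· ≤ ·)
      (fun m : ℕ => (⊥ : Ideal R).colon ((J ^ m : Ideal R) : Set R)) := by
    refine Monotone.directed_le fun m n hmn x hx => ?_
    rw [Submodule.mem_colon] at hx ⊢
    exact fun y hy => hx y (Ideal.pow_le_pow_right hmn hy)
  rw [zeroColonInfty, Submodule.mem_iSup_of_directed _ hdir]
  simp only [Submodule.mem_colon, SetLike.mem_coe, smul_eq_mul, Ideal.mem_bot]

/-- The weighted initial form of a polynomial: its weighted homogeneous part of least weighted
degree, where the variable `i` has degree `w i`. It is `0` for the zero polynomial. -/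
noncomputable def weightedInitialForm {R : Type*} [CommRing R] {σ : Type*} (w : σ → ℕ)
    (f : MvPolynomial σ R) : MvPolynomial σ R :=
  MvPolynomial.weightedHomogeneousComponent w
    (sInf {n : ℕ | MvPolynomial.weightedHomogeneousComponent w n f ≠ 0}) f

/-- `a₁, …, aₛ` is a weighted independent sequence with respect to the weight sequence `w`: for
every polynomial vanishing at `a₁, …, aₛ`, no coefficient of its weighted initial form is
invertible. (Indices start at `0`; only the first `s` weights matter.) -/
def IsWeightedIndependent {R : Type*} [CommRing R] (w : ℕ → ℕ) {s : ℕ} (a : Fin s → R) : Prop :=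
  ∀ f : MvPolynomial (Fin s) R, MvPolynomial.eval a f = 0 →
    ∀ m : Fin s →₀ ℕ,
      ¬ IsUnit (MvPolynomial.coeff m (weightedInitialForm (fun i : Fin s => w i) f))

/-- The set of lengths of the sequences in `J` that are weighted independent with respect to `w`;
the empty sequence has length `0`. -/
def weightedIndependentLengths {R : Type*} [CommRing R] (w : ℕ → ℕ) (J : Ideal R) : Set ℕ :=
  {s : ℕ | ∃ a : Fin s → R, (∀ i, a i ∈ J) ∧ IsWeightedIndependent w a}

/-! Write `K` for 0 : J^∞. For dim R/K ≤ sup, take a minimal prime `P` of `K`. Since `J ⊄ P`, some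
`c ∈ J` is nonzero in the domain R/P. A prime `q` of height `d` in R/P is minimal over `d` elements;
lift these to `z i`. The sequence `(c * z i) ^ w i` lies in `J`, and modulo `P` its relations turn,
after cancelling a power of `c`, into relations between the `d` elements whose lowest forms carry
the same coefficients. By `coeff_mem_of_eval_eq_zero` these lie in `q`, so they are not units.
Conversely, an independent sequence of length s yields a prime `P` containing no `a i` and a prime
`p ⊇ P` such that relations over D = R/P have initial coefficients in p/P
(`IsWeightedIndependent.exists_isPrime`). Then the extended Rees algebra D[t, aᵢ/t^{wᵢ}] maps onto
(D/p)[x₁,…,xₛ] with t ↦ 0, so it has dimension at least s + 1. It is D[t][x₁,…,xₛ] modulo a prime of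
height at least s, whence s + (s + 1) ≤ dim D + 1 + s. If s > 0, some `a i ∈ J` lies outside `P`, so
`K ≤ P` and s ≤ dim R/K. -/

/-! ### Relations between parameters -/

/-- The coefficients of the initial form of a relation between the elements of a system of
parameters lie in the prime ideal. -/
theorem coeff_mem_of_eval_eq_zero {R : Type*} [CommRing R] [IsNoetherianRing R] {d : ℕ}
    {p : Ideal R} [p.IsPrime] (hd : p.height = d) (y : Fin d → R)
    (hy : p ∈ (Ideal.span (Set.range y)).minimalPrimes)
    (f : MvPolynomial (Fin d) R) (hf : MvPolynomial.eval y f = 0) (n : ℕ)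
    (hlow : ∀ α, α.degree < n → f.coeff α = 0)
    (m : Fin d →₀ ℕ) (hm : m.degree = n) : f.coeff m ∈ p := by
  classical
  have hyp : ∀ i, y i ∈ p := fun i => hy.1.2 (Ideal.subset_span ⟨i, rfl⟩)
  rcases d with _ | e
  · obtain ⟨c, rfl⟩ := MvPolynomial.C_surjective (Fin 0) f
    have : c = 0 := by simpa using hf
    simp [this]
  by_contra hmp
  set P : Ideal (MvPolynomial (Fin (e + 1)) R) :=
    RingHom.ker (MvPolynomial.map (Ideal.Quotient.mk p)) with hP
  have hPprime : P.IsPrime := RingHom.ker_isPrime _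
  have hCP : ∀ r : R, MvPolynomial.C r ∈ P ↔ r ∈ p := fun r => by
    rw [hP, RingHom.mem_ker, MvPolynomial.map_C, MvPolynomial.C_eq_zero,
      Ideal.Quotient.eq_zero_iff_mem]
  have hover : P.LiesOver p := ⟨by ext r; exact (hCP r).symm⟩
  have hheight : (e + 1 : ℕ) ≤ P.height := by
    rw [Ideal.height_eq_height_add_of_liesOver_of_hasGoingDown p P, hd]
    exact le_self_add
  -- Only `e` elements, while `P = pR[x]` has height at least `e + 1`: by Krull's height theorem `P`
  -- cannot be minimal over them. A coefficient outside `p` would make it minimal.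
  set g : Fin e → MvPolynomial (Fin (e + 1)) R := fun i =>
    MvPolynomial.X 0 * MvPolynomial.C (y i.succ) - MvPolynomial.X i.succ * MvPolynomial.C (y 0)
    with hg
  have hgP : Ideal.span (Set.range g) ≤ P := by
    rw [Ideal.span_le]
    rintro _ ⟨i, rfl⟩
    exact P.sub_mem (P.mul_mem_left _ ((hCP _).2 (hyp _))) (P.mul_mem_left _ ((hCP _).2 (hyp _)))
  have hX : (MvPolynomial.X 0 : MvPolynomial (Fin (e + 1)) R) ∉ P := by
    simp [hP, RingHom.mem_ker]
  suffices hmin : P ∈ (Ideal.span (Set.range g)).minimalPrimes by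
    have h1 := Ideal.height_le_card_of_mem_minimalPrimes_span (Set.finite_range g) hmin
    have h2 : (Set.range g).ncard ≤ e := by
      rw [← Set.image_univ]
      exact (Set.ncard_image_le Set.finite_univ).trans (by simp)
    have h3 : ((e + 1 : ℕ) : ℕ∞) ≤ (e : ℕ) := hheight.trans (h1.trans (by exact_mod_cast h2))
    have h4 : e + 1 ≤ e := by exact_mod_cast h3
    omega
  refine ⟨⟨hPprime, hgP⟩, ?_⟩
  rintro Q ⟨hQprime, hgQ⟩ hQP
  have hXQ : (MvPolynomial.X 0 : MvPolynomial (Fin (e + 1)) R) ∉ Q := fun h => hX (hQP h)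
  set π := Ideal.Quotient.mk Q with hπ
  have hτ : π (MvPolynomial.X 0) ≠ 0 := by rwa [Ne, hπ, Ideal.Quotient.eq_zero_iff_mem]
  have hrel : ∀ i, π (MvPolynomial.X 0) * π (MvPolynomial.C (y i)) =
      π (MvPolynomial.X i) * π (MvPolynomial.C (y 0)) := by
    intro i
    refine Fin.cases rfl (fun i => ?_) i
    rw [← sub_eq_zero, ← map_mul, ← map_mul, ← map_sub, hπ, Ideal.Quotient.eq_zero_iff_mem]
    exact hgQ (Ideal.subset_span ⟨i, rfl⟩)
  have hzero : π (MvPolynomial.C (y 0)) = 0 := by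
    by_contra hη
    set N := f.totalDegree with hN
    -- Modulo `Q`, replacing each `X 0 * y i` by `X i * y 0` turns `X 0 ^ N * f(y)` into `y 0 ^ n *
    -- H`.
    set H : MvPolynomial (Fin (e + 1)) R := ∑ α ∈ f.support, MvPolynomial.C (f.coeff α) *
      MvPolynomial.X 0 ^ (N - α.degree) * MvPolynomial.C (y 0) ^ (α.degree - n) *
      ∏ i, MvPolynomial.X i ^ α i with hH
    have hdeg : ∀ α ∈ f.support, α.degree ≤ N := fun α hα => by
      rw [hN, Finsupp.degree_eq_sum]
      have := MvPolynomial.le_totalDegree hα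
      rwa [Finsupp.sum_fintype _ _ (by simp)] at this
    have hn : ∀ α ∈ f.support, n ≤ α.degree := fun α hα => by
      by_contra h
      exact MvPolynomial.mem_support_iff.1 hα (hlow α (not_le.1 h))
    have key : π (MvPolynomial.X 0) ^ N * π (MvPolynomial.C (MvPolynomial.eval y f)) =
        π (MvPolynomial.C (y 0)) ^ n * π H := by
      rw [MvPolynomial.eval_eq', hH]
      simp only [map_sum, map_mul, map_prod, map_pow, Finset.mul_sum]
      refine Finset.sum_congr rfl fun α hα => ?_
      have e1 : π (MvPolynomial.X 0) ^ α.degree * ∏ i, π (MvPolynomial.C (y i)) ^ α i =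
          π (MvPolynomial.C (y 0)) ^ α.degree * ∏ i, π (MvPolynomial.X i) ^ α i := by
        rw [Finsupp.degree_eq_sum, ← Finset.prod_pow_eq_pow_sum, ← Finset.prod_pow_eq_pow_sum,
          ← Finset.prod_mul_distrib, ← Finset.prod_mul_distrib]
        refine Finset.prod_congr rfl fun i _ => ?_
        rw [← mul_pow, ← mul_pow, hrel i, mul_comm]
      have e2 : π (MvPolynomial.X 0) ^ N =
          π (MvPolynomial.X 0) ^ (N - α.degree) * π (MvPolynomial.X 0) ^ α.degree := by
        rw [← pow_add, Nat.sub_add_cancel (hdeg α hα)]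
      have e3 : π (MvPolynomial.C (y 0)) ^ α.degree =
          π (MvPolynomial.C (y 0)) ^ n * π (MvPolynomial.C (y 0)) ^ (α.degree - n) := by
        rw [← pow_add, Nat.add_sub_cancel' (hn α hα)]
      rw [e3] at e1
      rw [e2]
      linear_combination (π (MvPolynomial.C (f.coeff α)) *
        π (MvPolynomial.X 0) ^ (N - α.degree)) * e1
    rw [hf, map_zero, map_zero, mul_zero] at key
    have hHQ : H ∈ P := by
      refine hQP ?_
      rw [← Ideal.Quotient.eq_zero_iff_mem]
      exact (mul_eq_zero.1 key.symm).resolve_left (pow_ne_zero _ hη)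
    set F := MvPolynomial.weightedHomogeneousComponent (fun _ : Fin (e + 1) => 1) n f with hF
    have hFP : F ∉ P := by
      intro h
      apply hmp
      rw [hP, RingHom.mem_ker] at h
      have := congrArg (MvPolynomial.coeff m) h
      rwa [MvPolynomial.coeff_map, MvPolynomial.coeff_zero, hF,
        MvPolynomial.coeff_weightedHomogeneousComponent, if_pos
          (by rw [← hm, Finsupp.degree_eq_weight_one]), Ideal.Quotient.eq_zero_iff_mem] at this
    -- Terms of degree above `n` keep a factor `y 0 ∈ p`, so only the lowest form survives modulo
    -- `P`.
    have hmain : H - MvPolynomial.X 0 ^ (N - n) * F ∈ P := by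
      have hFsum : F = ∑ α ∈ f.support with α.degree = n,
          MvPolynomial.C (f.coeff α) * ∏ i, MvPolynomial.X i ^ α i := by
        rw [hF, MvPolynomial.weightedHomogeneousComponent_apply]
        refine Finset.sum_congr ?_ fun α _ => ?_
        · ext α; simp [Finsupp.degree_eq_weight_one]
        · rw [MvPolynomial.monomial_eq, Finsupp.prod_fintype _ _ (by simp)]
      rw [hFsum, Finset.sum_filter, Finset.mul_sum, hH, ← Finset.sum_sub_distrib]
      refine P.sum_mem fun α hα => ?_
      split_ifs with h
      · convert! P.zero_mem
        rw [h, Nat.sub_self, pow_zero]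
        ring
      · rw [mul_zero, sub_zero]
        have : α.degree - n ≠ 0 := by have := hn α hα; omega
        exact P.mul_mem_right _ (P.mul_mem_left _ (P.pow_mem_of_mem ((hCP _).2 (hyp 0)) _
          (Nat.pos_of_ne_zero this)))
    have : MvPolynomial.X 0 ^ (N - n) * F ∈ P := by
      simpa using P.sub_mem hHQ hmain
    rcases hPprime.mem_or_mem this with h | h
    · exact hX (hPprime.mem_of_pow_mem _ h)
    · exact hFP h
  have hyQ : Ideal.span (Set.range y) ≤ Q.comap MvPolynomial.C := by
    rw [Ideal.span_le]
    rintro _ ⟨i, rfl⟩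
    rw [SetLike.mem_coe, Ideal.mem_comap, ← Ideal.Quotient.eq_zero_iff_mem]
    have := hrel i
    rw [hzero, mul_zero] at this
    exact (mul_eq_zero.1 this).resolve_left hτ
  have hpQ : p ≤ Q.comap MvPolynomial.C :=
    hy.2 ⟨Ideal.comap_isPrime _ _, hyQ⟩ fun r hr => (hCP r).1 (hQP hr)
  intro h hh
  rw [← h.support_sum_monomial_coeff]
  refine Q.sum_mem fun α _ => ?_
  have hα : h.coeff α ∈ p := by
    rw [hP, RingHom.mem_ker] at hh
    have := congrArg (MvPolynomial.coeff α) hh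
    rwa [MvPolynomial.coeff_map, MvPolynomial.coeff_zero, Ideal.Quotient.eq_zero_iff_mem] at this
  rw [← mul_one (h.coeff α), ← MvPolynomial.C_mul_monomial]
  exact Q.mul_mem_right _ (hpQ hα)

/-! ### Dimension bound from the extended Rees algebra -/

/-- The height of a prime ideal plus the dimension of its quotient is at most the dimension of the
ring. -/
theorem height_add_ringKrullDim_quotient_le {R : Type*} [CommRing R] (q : Ideal R) [hq : q.IsPrime] :
    (q.height : WithBot ℕ∞) + ringKrullDim (R ⧸ q) ≤ ringKrullDim R := by
  set x : PrimeSpectrum R := ⟨q, hq⟩ with hx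
  have : Nonempty (PrimeSpectrum R) := ⟨x⟩
  have h1 : ringKrullDim (R ⧸ q) = (Order.coheight x : WithBot ℕ∞) := by
    rw [ringKrullDim_quotient, Order.coheight_eq_krullDim_Ici]
    exact Order.krullDim_eq_of_orderIso (OrderIso.setCongr _ _ (by ext; rfl))
  rw [h1, ringKrullDim, Order.krullDim_eq_iSup_height_add_coheight_of_nonempty, ← WithBot.coe_add,
    WithBot.coe_le_coe, show q.height = Order.height x from x.height_eq_orderHeight]
  exact le_iSup (fun a : PrimeSpectrum R => Order.height a + Order.coheight a) x

/-- The kernel of the evaluation of polynomials in `s` variables at elements of a fraction field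
has height at least `s`. -/
theorem le_height_ker_eval₂Hom {A K : Type*} [CommRing A] [IsDomain A] [Field K] [Algebra A K]
    [IsFractionRing A K] {s : ℕ} (b : Fin s → K) :
    (s : ℕ∞) ≤ (RingHom.ker (MvPolynomial.eval₂Hom (algebraMap A K) b)).height := by
  -- Substituting the `b i` one variable at a time gives a chain of prime kernels. With `b j = x /
  -- y`, the polynomial `y * X j - x` shows that step `j` is strict.
  let v : ℕ → Fin s → MvPolynomial (Fin s) K := fun j i =>
    if (i : ℕ) < j then MvPolynomial.C (b i) else MvPolynomial.X i
  let φ : ℕ → MvPolynomial (Fin s) A →+* MvPolynomial (Fin s) K := fun j =>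
    MvPolynomial.eval₂Hom (MvPolynomial.C.comp (algebraMap A K)) (v j)
  have hφX : ∀ j i, φ j (MvPolynomial.X i) = v j i := fun j i => by simp [φ]
  have hφC : ∀ j r, φ j (MvPolynomial.C r) = MvPolynomial.C (algebraMap A K r) := fun j r => by
    simp [φ]
  have hprime : ∀ j, (RingHom.ker (φ j)).IsPrime := fun j => RingHom.ker_isPrime _
  have hle : ∀ j, RingHom.ker (φ j) ≤ RingHom.ker (φ (j + 1)) := by
    intro j
    have : φ (j + 1) = (MvPolynomial.eval₂Hom MvPolynomial.C (v (j + 1))).comp (φ j) := by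
      refine MvPolynomial.ringHom_ext (fun r => by simp [φ]) fun i => ?_
      rw [RingHom.comp_apply, hφX, hφX]
      by_cases h : (i : ℕ) < j
      · simp [v, h, h.trans (Nat.lt_succ_self j)]
      · simp [v, h]
    rw [this]
    intro f hf
    rw [RingHom.mem_ker] at hf ⊢
    rw [RingHom.comp_apply, hf, map_zero]
  have hlt : ∀ j < s, RingHom.ker (φ j) < RingHom.ker (φ (j + 1)) := by
    intro j hj
    refine lt_of_le_of_ne (hle j) fun heq => ?_
    obtain ⟨x, y, hy, hxy⟩ := IsFractionRing.div_surjective (A := A) (b ⟨j, hj⟩)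
    have hy0 : algebraMap A K y ≠ 0 :=
      IsFractionRing.to_map_ne_zero_of_mem_nonZeroDivisors hy
    set f : MvPolynomial (Fin s) A :=
      MvPolynomial.C y * MvPolynomial.X ⟨j, hj⟩ - MvPolynomial.C x with hf
    have h1 : f ∈ RingHom.ker (φ (j + 1)) := by
      rw [RingHom.mem_ker, hf, map_sub, map_mul, hφX, hφC, hφC]
      simp only [v, Nat.lt_succ_self, if_true]
      rw [← map_mul, ← map_sub, ← hxy, mul_div_cancel₀ _ hy0, sub_self, map_zero]
    rw [← heq, RingHom.mem_ker, hf, map_sub, map_mul, hφX, hφC, hφC] at h1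
    simp only [v, lt_irrefl, if_false] at h1
    have := congrArg (MvPolynomial.coeff (Finsupp.single (⟨j, hj⟩ : Fin s) 1)) h1
    rw [MvPolynomial.coeff_sub, MvPolynomial.coeff_C_mul, MvPolynomial.coeff_X,
      MvPolynomial.coeff_C, if_pos rfl,
      if_neg (fun h => one_ne_zero (Finsupp.single_eq_zero.1 h.symm)), mul_one, sub_zero] at this
    exact hy0 this
  have hker : RingHom.ker (MvPolynomial.eval₂Hom (algebraMap A K) b) = RingHom.ker (φ s) := by
    have : φ s = MvPolynomial.C.comp (MvPolynomial.eval₂Hom (algebraMap A K) b) :=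
      MvPolynomial.ringHom_ext (fun r => by simp [φ]) fun i => by simp [φ, v]
    ext f
    rw [this, RingHom.mem_ker, RingHom.mem_ker, RingHom.comp_apply, MvPolynomial.C_eq_zero]
  rw [hker]
  have : ∀ j ≤ s, (j : ℕ∞) ≤ (RingHom.ker (φ j)).height := by
    intro j
    induction j with
    | zero => simp
    | succ j ih =>
      intro hj
      have := hprime j
      have := hprime (j + 1)
      refine le_trans ?_ (Ideal.height_add_one_le_of_lt_of_isPrime (hlt j hj))
      push_cast
      gcongr
      exact ih (by omega)
  exact this s le_rfl

-- Substituting aᵢ/t^{wᵢ} sends t^k x^α to a multiple of t^{k - w(α)}. Collecting the terms with k -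
-- w(α) = -w(β) gives a relation over `D` with no terms of weight below w(β), whose coefficient at β
-- is the constant term of `f.coeff β`.
open Polynomial in
theorem coeff_zero_mem_of_eval₂Hom_eq_zero {D K : Type*} [CommRing D] [IsDomain D] [Field K]
    [Algebra D[X] K] [IsFractionRing D[X] K] {s : ℕ} (w : Fin s → ℕ) (a : Fin s → D) (p : Ideal D)
    (h : ∀ f : MvPolynomial (Fin s) D, MvPolynomial.eval a f = 0 → ∀ β,
      (∀ α, Finsupp.weight w α < Finsupp.weight w β → f.coeff α = 0) → f.coeff β ∈ p)
    (f : MvPolynomial (Fin s) D[X])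
    (hf : MvPolynomial.eval₂Hom (algebraMap D[X] K)
      (fun i => algebraMap D[X] K (C (a i)) / algebraMap D[X] K X ^ w i) f = 0)
    (β : Fin s →₀ ℕ) : (f.coeff β).coeff 0 ∈ p := by
  classical
  set n := Finsupp.weight w β with hn
  set g : MvPolynomial (Fin s) D := ∑ α ∈ f.support, MvPolynomial.monomial α
    (if n ≤ Finsupp.weight w α then (f.coeff α).coeff (Finsupp.weight w α - n) else 0) with hg
  have hcoeff : ∀ α, g.coeff α =
      if n ≤ Finsupp.weight w α then (f.coeff α).coeff (Finsupp.weight w α - n) else 0 := by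
    intro α
    rw [hg, MvPolynomial.coeff_sum]
    simp only [MvPolynomial.coeff_monomial]
    rw [Finset.sum_ite_eq']
    split_ifs with h1 h2
    · rfl
    · rfl
    · rw [MvPolynomial.notMem_support_iff.1 h1, coeff_zero]
    · rfl
  have hX : algebraMap D[X] K X ≠ 0 := by
    simp
  -- Multiplying by t^N clears all denominators; `eval a g` is then the coefficient of t^{N - n}.
  have heval : MvPolynomial.eval a g = 0 := by
    set N := n + ∑ α ∈ f.support, Finsupp.weight w α with hN
    have hwN : ∀ α ∈ f.support, Finsupp.weight w α ≤ N := fun α hα =>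
      (Finset.single_le_sum (f := fun α => Finsupp.weight w α) (fun _ _ => Nat.zero_le _) hα).trans
        (Nat.le_add_left _ _)
    set E : D[X] := ∑ α ∈ f.support, f.coeff α * C (∏ i, a i ^ α i) *
      X ^ (N - Finsupp.weight w α) with hE
    have hE0 : E = 0 := by
      apply IsFractionRing.injective D[X] K
      rw [map_zero, ← mul_zero (algebraMap D[X] K X ^ N), ← hf, MvPolynomial.coe_eval₂Hom,
        MvPolynomial.eval₂_eq', hE, map_sum, Finset.mul_sum]
      refine Finset.sum_congr rfl fun α hα => ?_
      simp only [div_pow, Finset.prod_div_distrib, map_mul, map_pow, map_prod]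
      have : ∏ i, (algebraMap D[X] K X ^ w i) ^ α i =
          algebraMap D[X] K X ^ Finsupp.weight w α := by
        rw [Finsupp.weight_eq_sum, ← Finset.prod_pow_eq_pow_sum]
        refine Finset.prod_congr rfl fun i _ => ?_
        rw [← pow_mul, smul_eq_mul, mul_comm]
      rw [this, pow_sub₀ _ hX (hwN α hα)]
      field_simp
    have := congrArg (fun e : D[X] => e.coeff (N - n)) hE0
    simp only [hE, finsetSum_coeff, coeff_zero, coeff_mul_X_pow', coeff_mul_C] at this
    rw [hg, map_sum]
    refine Eq.trans ?_ this
    refine Finset.sum_congr rfl fun α hα => ?_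
    rw [MvPolynomial.eval_monomial, Finsupp.prod_fintype _ _ (by simp)]
    have h1 := hwN α hα
    by_cases h2 : n ≤ Finsupp.weight w α
    · rw [if_pos h2, if_pos (by omega), show N - n - (N - Finsupp.weight w α) =
        Finsupp.weight w α - n by omega]
    · rw [if_neg h2, if_neg (by omega), zero_mul]
  have := h g heval β fun α hα => by rw [hcoeff, if_neg (not_le.2 hα)]
  rwa [hcoeff, if_pos le_rfl, Nat.sub_self] at this

theorem le_of_add_add_one_le {s : ℕ} {d : WithBot ℕ∞} (hd : 0 ≤ d)
    (h : (s : WithBot ℕ∞) + (s + 1) ≤ d + 1 + s) : (s : WithBot ℕ∞) ≤ d := by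
  induction d with
  | bot => simp at hd
  | coe d =>
    induction d with
    | top => exact le_top
    | coe d =>
      have : s + (s + 1) ≤ d + 1 + s := by exact_mod_cast h
      have : s ≤ d := by omega
      exact_mod_cast this

/-- `E` is a quotient of the domain `A ⧸ ker θ` in which the nonzero element `x` dies, which costs
one dimension. -/
theorem height_ker_add_ringKrullDim_add_one_le {A B E : Type*} [CommRing A] [CommRing B] [IsDomain B]
    [CommRing E] (θ : A →+* B) (ψ : A →+* E) (hψ : Function.Surjective ψ)
    (hker : RingHom.ker θ ≤ RingHom.ker ψ) {x : A} (hx : θ x ≠ 0) (hx' : ψ x = 0) :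
    ((RingHom.ker θ).height : WithBot ℕ∞) + (ringKrullDim E + 1) ≤ ringKrullDim A := by
  have hprime : (RingHom.ker θ).IsPrime := RingHom.ker_isPrime _
  have hX : Ideal.Quotient.mk (RingHom.ker θ) x ∈ nonZeroDivisors (A ⧸ RingHom.ker θ) := by
    rwa [mem_nonZeroDivisors_iff_ne_zero, Ne, Ideal.Quotient.eq_zero_iff_mem, RingHom.mem_ker]
  let F : A ⧸ RingHom.ker θ →+* E := Ideal.Quotient.lift (RingHom.ker θ) ψ hker
  have hF : Function.Surjective F := Ideal.Quotient.lift_surjective_of_surjective _ _ hψ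
  have h1 := ringKrullDim_succ_le_of_surjective F hF hX
    ((Ideal.Quotient.lift_mk _ _ _).trans hx')
  exact le_trans (by gcongr) (height_add_ringKrullDim_quotient_le (RingHom.ker θ))

open Polynomial in
theorem le_ringKrullDim_of_initial_coeff_mem_of_isFractionRing (K : Type*) {D : Type*} [CommRing D]
    [IsDomain D] [IsNoetherianRing D] [Field K] [Algebra D[X] K] [IsFractionRing D[X] K] {s : ℕ}
    (w : Fin s → ℕ) (a : Fin s → D) (p : Ideal D) [p.IsPrime]
    (h : ∀ f : MvPolynomial (Fin s) D, MvPolynomial.eval a f = 0 → ∀ β,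
      (∀ α, Finsupp.weight w α < Finsupp.weight w β → f.coeff α = 0) → f.coeff β ∈ p) :
    (s : WithBot ℕ∞) ≤ ringKrullDim D := by
  obtain ⟨θ, hθ⟩ : ∃ θ : MvPolynomial (Fin s) D[X] →+* K, θ = MvPolynomial.eval₂Hom
    (algebraMap D[X] K) (fun i => algebraMap D[X] K (C (a i)) / algebraMap D[X] K X ^ w i) :=
    ⟨_, rfl⟩
  obtain ⟨ψ, hψ⟩ : ∃ ψ : MvPolynomial (Fin s) D[X] →+* MvPolynomial (Fin s) (D ⧸ p),
    ψ = MvPolynomial.map ((Ideal.Quotient.mk p).comp constantCoeff) := ⟨_, rfl⟩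
  have hheight : (s : ℕ∞) ≤ (RingHom.ker θ).height := hθ ▸ le_height_ker_eval₂Hom _
  have hsurj : Function.Surjective ψ := hψ ▸ MvPolynomial.map_surjective _
    (Ideal.Quotient.mk_surjective.comp constantCoeff_surjective)
  have hker : ∀ f ∈ RingHom.ker θ, ψ f = 0 := by
    intro f hf
    ext β
    rw [hψ, MvPolynomial.coeff_map, MvPolynomial.coeff_zero, RingHom.comp_apply,
      Ideal.Quotient.eq_zero_iff_mem, constantCoeff_apply]
    exact coeff_zero_mem_of_eval₂Hom_eq_zero w a p h f (hθ ▸ hf) β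
  have h2 := height_ker_add_ringKrullDim_add_one_le θ ψ hsurj hker (x := MvPolynomial.C X)
    (by simp [hθ]) (by rw [hψ, MvPolynomial.map_C]; simp)
  rw [MvPolynomial.ringKrullDim_of_isNoetherianRing, MvPolynomial.ringKrullDim_of_isNoetherianRing,
    Nat.card_fin, Polynomial.ringKrullDim_of_isNoetherianRing] at h2
  have h3 : (0 : WithBot ℕ∞) ≤ ringKrullDim (D ⧸ p) := ringKrullDim_nonneg_of_nontrivial
  refine le_of_add_add_one_le ringKrullDim_nonneg_of_nontrivial (le_trans ?_ h2)
  refine add_le_add (by exact_mod_cast hheight) ?_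
  gcongr
  simpa using add_le_add_left h3 (s : WithBot ℕ∞)

open Polynomial in
theorem le_ringKrullDim_of_initial_coeff_mem {D : Type*} [CommRing D] [IsDomain D]
    [IsNoetherianRing D] {s : ℕ} (w : Fin s → ℕ) (a : Fin s → D) (p : Ideal D) [p.IsPrime]
    (h : ∀ f : MvPolynomial (Fin s) D, MvPolynomial.eval a f = 0 → ∀ β,
      (∀ α, Finsupp.weight w α < Finsupp.weight w β → f.coeff α = 0) → f.coeff β ∈ p) :
    (s : WithBot ℕ∞) ≤ ringKrullDim D :=
  le_ringKrullDim_of_initial_coeff_mem_of_isFractionRing (FractionRing D[X]) w a p h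

/-! ### Lowest-weight coefficients of relations -/

theorem IsWeightedIndependent.not_isUnit_coeff {R : Type*} [CommRing R] {w : ℕ → ℕ} {s : ℕ}
    {a : Fin s → R} (ha : IsWeightedIndependent w a) {f : MvPolynomial (Fin s) R}
    (hf : MvPolynomial.eval a f = 0) {β : Fin s →₀ ℕ}
    (hlow : ∀ α, Finsupp.weight (fun i : Fin s => w i) α < Finsupp.weight (fun i : Fin s => w i) β →
      f.coeff α = 0) : ¬ IsUnit (f.coeff β) := by
  classical
  intro hu
  rcases subsingleton_or_nontrivial R with hR | hR
  · exact ha 0 (map_zero _) 0 (isUnit_of_subsingleton _)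
  have hinf : sInf {n : ℕ | MvPolynomial.weightedHomogeneousComponent (fun i : Fin s => w i) n f ≠ 0}
      = Finsupp.weight (fun i : Fin s => w i) β := by
    refine IsLeast.csInf_eq ⟨fun h => ?_, fun n hn => ?_⟩
    · have := congrArg (MvPolynomial.coeff β) h
      rw [MvPolynomial.coeff_weightedHomogeneousComponent, if_pos rfl,
        MvPolynomial.coeff_zero] at this
      exact hu.ne_zero this
    · by_contra h
      refine hn (MvPolynomial.ext _ _ fun α => ?_)
      rw [MvPolynomial.coeff_weightedHomogeneousComponent, MvPolynomial.coeff_zero]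
      split_ifs with h1
      · exact hlow α (h1 ▸ not_le.1 h)
      · rfl
  apply ha f hf β
  rwa [weightedInitialForm, hinf, MvPolynomial.coeff_weightedHomogeneousComponent, if_pos rfl]

theorem isWeightedIndependent_of_not_isUnit_coeff {R : Type*} [CommRing R] [Nontrivial R]
    {w : ℕ → ℕ} {s : ℕ} {a : Fin s → R}
    (h : ∀ f : MvPolynomial (Fin s) R, MvPolynomial.eval a f = 0 → ∀ β : Fin s →₀ ℕ,
      (∀ α, Finsupp.weight (fun i : Fin s => w i) α < Finsupp.weight (fun i : Fin s => w i) β →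
        f.coeff α = 0) → ¬ IsUnit (f.coeff β)) : IsWeightedIndependent w a := by
  classical
  intro f hf β hu
  rw [weightedInitialForm, MvPolynomial.coeff_weightedHomogeneousComponent] at hu
  split_ifs at hu with hβ
  · refine h f hf β (fun α hα => ?_) hu
    have := Nat.notMem_of_lt_sInf (hβ ▸ hα)
    rw [Set.mem_ofPred_eq, not_not] at this
    have := congrArg (MvPolynomial.coeff α) this
    rwa [MvPolynomial.coeff_weightedHomogeneousComponent, if_pos rfl,
      MvPolynomial.coeff_zero] at this
  · exact not_isUnit_zero hu

/-- The ideal of the coefficients of the weighted initial forms of the polynomial relations between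
the elements of a family. -/
def initialCoeffIdeal {R σ : Type*} [CommRing R] (w : σ → ℕ) (a : σ → R) : Ideal R where
  carrier := {c | ∃ f : MvPolynomial σ R, MvPolynomial.eval a f = 0 ∧ ∃ β,
    (∀ α, Finsupp.weight w α < Finsupp.weight w β → f.coeff α = 0) ∧ f.coeff β = c}
  zero_mem' := ⟨0, map_zero _, 0, fun _ _ => MvPolynomial.coeff_zero _, MvPolynomial.coeff_zero _⟩
  add_mem' := by
    classical
    rintro _ _ ⟨f, hf, β, hfβ, rfl⟩ ⟨g, hg, γ, hgγ, rfl⟩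
    -- The monomial factors move both initial coefficients to the common exponent `γ + β`.
    refine ⟨MvPolynomial.monomial γ 1 * f + MvPolynomial.monomial β 1 * g, by simp [hf, hg],
      γ + β, fun α hα => ?_, ?_⟩
    · rw [MvPolynomial.coeff_add, MvPolynomial.coeff_monomial_mul',
        MvPolynomial.coeff_monomial_mul']
      rw [map_add] at hα
      have h1 : γ ≤ α → f.coeff (α - γ) = 0 := fun h => hfβ _ (by
        have := congrArg (Finsupp.weight w) (tsub_add_cancel_of_le h)
        rw [map_add] at this
        omega)
      have h2 : β ≤ α → g.coeff (α - β) = 0 := fun h => hgγ _ (by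
        have := congrArg (Finsupp.weight w) (tsub_add_cancel_of_le h)
        rw [map_add] at this
        omega)
      split_ifs with h3 h4 h4 <;> simp [*]
    · rw [MvPolynomial.coeff_add, MvPolynomial.coeff_monomial_mul, add_comm γ β,
        MvPolynomial.coeff_monomial_mul, one_mul, one_mul]
  smul_mem' := by
    rintro r _ ⟨f, hf, β, hfβ, rfl⟩
    refine ⟨MvPolynomial.C r * f, by simp [hf], β, fun α hα => ?_, ?_⟩
    · rw [MvPolynomial.coeff_C_mul, hfβ α hα, mul_zero]
    · rw [MvPolynomial.coeff_C_mul, smul_eq_mul]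

/-- The submonoid of the values at a family of elements of the polynomials whose weighted initial
form has a coefficient outside a prime ideal. -/
def initialCoeffSubmonoid {R σ : Type*} [CommRing R] (w : σ → ℕ) (a : σ → R) (p : Ideal R)
    [hp : p.IsPrime] : Submonoid R where
  carrier := {r | ∃ f : MvPolynomial σ R, MvPolynomial.eval a f = r ∧ ∃ β,
    (∀ α, Finsupp.weight w α < Finsupp.weight w β → f.coeff α = 0) ∧ f.coeff β ∉ p}
  one_mem' := by
    refine ⟨1, map_one _, 0, fun α hα => absurd hα (by simp), ?_⟩
    rw [MvPolynomial.coeff_zero_one]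
    exact (Ideal.ne_top_iff_one p).1 hp.ne_top
  mul_mem' := by
    classical
    rintro _ _ ⟨f, rfl, β, hfβ, hf⟩ ⟨g, rfl, γ, hgγ, hg⟩
    set F := MvPolynomial.weightedHomogeneousComponent w (Finsupp.weight w β) f with hF
    set G := MvPolynomial.weightedHomogeneousComponent w (Finsupp.weight w γ) g with hG
    have hFp : MvPolynomial.map (Ideal.Quotient.mk p) F ≠ 0 := fun h => hf (by
      have := congrArg (MvPolynomial.coeff β) h
      rwa [MvPolynomial.coeff_map, hF, MvPolynomial.coeff_weightedHomogeneousComponent, if_pos rfl,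
        MvPolynomial.coeff_zero, Ideal.Quotient.eq_zero_iff_mem] at this)
    have hGp : MvPolynomial.map (Ideal.Quotient.mk p) G ≠ 0 := fun h => hg (by
      have := congrArg (MvPolynomial.coeff γ) h
      rwa [MvPolynomial.coeff_map, hG, MvPolynomial.coeff_weightedHomogeneousComponent, if_pos rfl,
        MvPolynomial.coeff_zero, Ideal.Quotient.eq_zero_iff_mem] at this)
    -- Polynomials over the domain R/p form a domain, so `F * G` has a coefficient outside `p`; by
    -- homogeneity its weight is that of `β + γ`.
    obtain ⟨δ, hδ⟩ := MvPolynomial.ne_zero_iff.1 (mul_ne_zero hFp hGp)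
    rw [← map_mul, MvPolynomial.coeff_map, Ne, Ideal.Quotient.eq_zero_iff_mem] at hδ
    have hw : Finsupp.weight w δ = Finsupp.weight w β + Finsupp.weight w γ :=
      ((MvPolynomial.weightedHomogeneousComponent_isWeightedHomogeneous _ f).mul
        (MvPolynomial.weightedHomogeneousComponent_isWeightedHomogeneous _ g))
        (fun h => hδ (h ▸ p.zero_mem))
    refine ⟨f * g, map_mul _ _ _, δ, fun α hα => ?_, ?_⟩
    · rw [MvPolynomial.coeff_mul]
      refine Finset.sum_eq_zero fun x hx => ?_
      have := congrArg (Finsupp.weight w) (Finset.HasAntidiagonal.mem_antidiagonal.1 hx)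
      rw [map_add] at this
      rcases lt_or_ge (Finsupp.weight w x.1) (Finsupp.weight w β) with h | h
      · rw [hfβ _ h, zero_mul]
      · rw [hgγ x.2 (by omega), mul_zero]
    · convert hδ using 1
      rw [MvPolynomial.coeff_mul, MvPolynomial.coeff_mul]
      refine iff_of_eq <| congrArg (· ∈ p) (Finset.sum_congr rfl fun x hx => ?_)
      have := congrArg (Finsupp.weight w) (Finset.HasAntidiagonal.mem_antidiagonal.1 hx)
      rw [map_add] at this
      rw [hF, hG, MvPolynomial.coeff_weightedHomogeneousComponent,
        MvPolynomial.coeff_weightedHomogeneousComponent]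
      rcases lt_trichotomy (Finsupp.weight w x.1) (Finsupp.weight w β) with h | h | h
      · rw [hfβ _ h]; simp
      · rw [if_pos h, if_pos (by omega)]
      · rw [hgγ x.2 (by omega)]; simp

/-! ### From independent sequences to primes, and back -/

theorem zeroColonInfty_le_of_notMem {R : Type*} [CommRing R] {J p : Ideal R} [hp : p.IsPrime]
    {x : R} (hxJ : x ∈ J) (hx : x ∉ p) : zeroColonInfty J ≤ p := by
  intro k hk
  obtain ⟨n, hn⟩ := mem_zeroColonInfty.1 hk
  have := hn _ (Ideal.pow_mem_pow hxJ n)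
  refine (hp.mem_or_mem (this ▸ p.zero_mem : k * x ^ n ∈ p)).resolve_right fun h => ?_
  exact hx (hp.mem_of_pow_mem n h)

/-- Independence keeps 1 out of the ideal of initial coefficients, so a maximal `p` contains that
ideal. The values of polynomials with an initial coefficient outside `p` then form a submonoid
avoiding 0, and `P` is a prime disjoint from it. The polynomials `X i` and the constants outside `p`
give `a i ∉ P` and `P ≤ p`. -/
theorem IsWeightedIndependent.exists_isPrime {R : Type*} [CommRing R] [IsNoetherianRing R]
    {w : ℕ → ℕ} {s : ℕ} {a : Fin s → R} (ha : IsWeightedIndependent w a) :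
    ∃ P : Ideal R, P.IsPrime ∧ (∀ i, a i ∉ P) ∧ (s : WithBot ℕ∞) ≤ ringKrullDim (R ⧸ P) := by
  classical
  set v : Fin s → ℕ := fun i => w i with hv
  have hS : initialCoeffIdeal v a ≠ ⊤ := by
    rw [Ne, Ideal.eq_top_iff_one]
    rintro ⟨f, hf, β, hlow, h1⟩
    exact ha.not_isUnit_coeff hf hlow (h1 ▸ isUnit_one)
  obtain ⟨p, hpmax, hp⟩ := Ideal.exists_le_maximal _ hS
  have hpp : p.IsPrime := hpmax.isPrime
  have hdisj : Disjoint ((⊥ : Ideal R) : Set R) (initialCoeffSubmonoid v a p) := by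
    rw [Set.disjoint_left]
    rintro r hr ⟨f, hf, β, hlow, hβ⟩
    exact hβ (hp ⟨f, hf.trans hr, β, hlow, rfl⟩)
  obtain ⟨P, hP, -, hPd⟩ := Ideal.exists_le_prime_disjoint _ _ hdisj
  rw [Set.disjoint_right] at hPd
  have h1p : (1 : R) ∉ p := (Ideal.ne_top_iff_one p).1 hpp.ne_top
  have hPp : P ≤ p := by
    intro r hr
    by_contra h
    refine hPd ⟨MvPolynomial.C r, MvPolynomial.eval_C _, 0, fun α hα => absurd hα (by simp), ?_⟩ hr
    simpa using h
  refine ⟨P, hP, fun i hi => ?_, ?_⟩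
  · refine hPd ⟨MvPolynomial.X i, MvPolynomial.eval_X _, Finsupp.single i 1, fun α hα => ?_, ?_⟩ hi
    · rw [MvPolynomial.coeff_X, if_neg]
      rintro rfl
      exact lt_irrefl _ hα
    · simpa using h1p
  have hp' : (p.map (Ideal.Quotient.mk P)).IsPrime := Ideal.isPrime_map_quotientMk_of_isPrime hPp
  refine le_ringKrullDim_of_initial_coeff_mem v (fun i => Ideal.Quotient.mk P (a i))
    (p.map (Ideal.Quotient.mk P)) fun f hf β hlow => ?_
  -- The lift must send 0 to 0, so that lifting `f` creates no terms of lower weight.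
  obtain ⟨l, hl, hl0⟩ : ∃ l : R ⧸ P → R, (∀ x, Ideal.Quotient.mk P (l x) = x) ∧ l 0 = 0 := by
    refine ⟨fun x => if x = 0 then 0 else Quotient.out x, fun x => ?_, if_pos rfl⟩
    dsimp only
    split_ifs with h
    · rw [h, map_zero]
    · exact Ideal.Quotient.mk_out x
  set F : MvPolynomial (Fin s) R := ∑ α ∈ f.support, MvPolynomial.monomial α (l (f.coeff α)) with hF
  have hFc : ∀ α, F.coeff α = l (f.coeff α) := by
    intro α
    rw [hF, MvPolynomial.coeff_sum]
    simp only [MvPolynomial.coeff_monomial]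
    rw [Finset.sum_ite_eq']
    split_ifs with h
    · rfl
    · rw [MvPolynomial.notMem_support_iff.1 h, hl0]
  have hFf : MvPolynomial.map (Ideal.Quotient.mk P) F = f :=
    MvPolynomial.ext _ _ fun α => by rw [MvPolynomial.coeff_map, hFc, hl]
  have hFP : MvPolynomial.eval a F ∈ P := by
    rw [← Ideal.Quotient.eq_zero_iff_mem, ← hf, ← hFf, MvPolynomial.eval_map,
      MvPolynomial.eval₂_comp]
    rfl
  rw [← hl (f.coeff β)]
  refine Ideal.mem_map_of_mem _ ?_
  rw [← hFc]
  by_contra h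
  exact hPd ⟨F, rfl, β, fun α hα => by rw [hFc, hlow α hα, hl0], h⟩ hFP

/-- A minimal prime of `K` = 0 : J^∞ has the form `K : x`, and by Noetherianity one power `J ^ m`
kills `K`. If `J ≤ P`, then `J * x ⊆ K`, so `J ^ (m + 1)` kills `x`; hence `x ∈ K` and `P = ⊤`. -/
theorem not_le_of_mem_minimalPrimes_zeroColonInfty {R : Type*} [CommRing R] [IsNoetherianRing R]
    {J P : Ideal R} (hP : P ∈ (zeroColonInfty J).minimalPrimes) : ¬ J ≤ P := by
  intro hJ
  have hcolon : (zeroColonInfty J).colon {(1 : R)} = zeroColonInfty J := by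
    ext x; simp [Submodule.mem_colon_singleton]
  rw [← hcolon] at hP
  obtain ⟨x, hx⟩ := Submodule.exists_eq_colon_of_mem_minimalPrimes hP
  rw [hcolon] at hP
  obtain ⟨m, hm⟩ : ∃ m : ℕ, ∀ k ∈ zeroColonInfty J, ∀ y ∈ J ^ m, k * y = 0 := by
    let N : ℕ →o Submodule R R := ⟨fun m => (⊥ : Ideal R).colon ((J ^ m : Ideal R) : Set R),
      fun m n hmn x hx => by
        rw [Submodule.mem_colon] at hx ⊢
        exact fun y hy => hx y (Ideal.pow_le_pow_right hmn hy)⟩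
    obtain ⟨m, hm⟩ := Submodule.FG.stabilizes_of_iSup_eq
      (IsNoetherian.noetherian (zeroColonInfty J)) N rfl
    refine ⟨m, fun k hk y hy => ?_⟩
    rw [hm] at hk
    simpa using Submodule.mem_colon.1 hk y hy
  have hxK : x ∈ zeroColonInfty J := by
    refine mem_zeroColonInfty.2 ⟨m + 1, fun y hy => ?_⟩
    rw [pow_succ] at hy
    induction hy using Submodule.mul_induction_on' with
    | mem_mul_mem b hb c hc =>
      have hc' := hJ hc
      rw [hx, Submodule.mem_colon_singleton] at hc'
      have := hm _ hc' b hb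
      rw [smul_eq_mul] at this
      linear_combination this
    | add b _ c _ hb hc => rw [mul_add, hb, hc, add_zero]
  have : P = ⊤ := by
    rw [hx]
    exact (Ideal.eq_top_iff_one _).2 (by simpa [Submodule.mem_colon_singleton] using hxK)
  exact hP.1.1.ne_top this

theorem mem_weightedIndependentLengths_of_height_eq {R : Type*} [CommRing R] [IsNoetherianRing R]
    {J P : Ideal R} [P.IsPrime] (hJ : ¬ J ≤ P) {w : ℕ → ℕ} (hw : ∀ i, 0 < w i)
    {q : Ideal (R ⧸ P)} [hq : q.IsPrime] {d : ℕ} (hd : q.height = d) :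
    d ∈ weightedIndependentLengths w J := by
  classical
  have : Nontrivial R := (Ideal.Quotient.mk P).domain_nontrivial
  obtain ⟨c, hcJ, hcP⟩ := Set.not_subset.1 hJ
  obtain ⟨S, hSq, hS⟩ := q.exists_finset_card_eq_height_of_isNoetherianRing
  obtain rfl : S.card = d := by rw [hd] at hS; exact_mod_cast hS
  set y : Fin S.card → R ⧸ P := fun i => (S.equivFin.symm i : R ⧸ P) with hy
  have hrange : Set.range y = (S : Set (R ⧸ P)) := by
    ext x
    refine ⟨?_, fun hx => ⟨S.equivFin ⟨x, hx⟩, by simp [hy]⟩⟩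
    rintro ⟨i, rfl⟩
    exact (S.equivFin.symm i).2
  rw [← hrange] at hSq
  choose z hz using fun i => Ideal.Quotient.mk_surjective (I := P) (y i)
  -- The factor `c` puts the elements in `J`; the exponents `w i` turn weighted degree into ordinary
  -- degree in the `y i`.
  refine ⟨fun i => (c * z i) ^ w i, fun i => J.pow_mem_of_mem (J.mul_mem_right _ hcJ) _ (hw i),
    isWeightedIndependent_of_not_isUnit_coeff fun f hf β hlow hu => ?_⟩
  set v : Fin S.card → ℕ := fun i => w i with hv
  set n := Finsupp.weight v β with hn
  set π := Ideal.Quotient.mk P with hπ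
  have hc : π c ≠ 0 := by rwa [Ne, hπ, Ideal.Quotient.eq_zero_iff_mem]
  let sc : (Fin S.card →₀ ℕ) → (Fin S.card →₀ ℕ) := fun α =>
    Finsupp.equivFunOnFinite.symm fun i => v i * α i
  have hsc : Function.Injective sc := by
    intro α γ h
    ext i
    have := DFunLike.congr_fun h i
    exact Nat.eq_of_mul_eq_mul_left (hw i) this
  have hdeg : ∀ α, (sc α).degree = Finsupp.weight v α := by
    intro α
    rw [Finsupp.degree_eq_sum, Finsupp.weight_eq_sum]
    exact Finset.sum_congr rfl fun i _ => mul_comm _ _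
  -- Modulo `P`, f(a) = c^n g(y). In degree `n` the power of `c` in `g` is trivial, so the initial
  -- coefficients of `f` survive.
  set g : MvPolynomial (Fin S.card) (R ⧸ P) := ∑ α ∈ f.support, MvPolynomial.monomial (sc α)
    (π (f.coeff α * c ^ (Finsupp.weight v α - n))) with hg
  have hgc : ∀ γ, g.coeff γ = ∑ α ∈ f.support, if sc α = γ then
      π (f.coeff α * c ^ (Finsupp.weight v α - n)) else 0 := by
    intro γ
    rw [hg, MvPolynomial.coeff_sum]
    simp only [MvPolynomial.coeff_monomial]
  have hsupp : ∀ α ∈ f.support, n ≤ Finsupp.weight v α := fun α hα => by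
    by_contra h
    exact MvPolynomial.mem_support_iff.1 hα (hlow α (not_le.1 h))
  have heval : MvPolynomial.eval y g = 0 := by
    refine (mul_eq_zero.1 (?_ : π c ^ n * _ = 0)).resolve_left (pow_ne_zero _ hc)
    rw [← map_zero π, ← hf, hg, map_sum, MvPolynomial.eval_eq' _ f, map_sum, Finset.mul_sum]
    refine Finset.sum_congr rfl fun α hα => ?_
    rw [MvPolynomial.eval_monomial, Finsupp.prod_fintype _ _ (by simp)]
    simp only [map_mul, map_pow, map_prod, hz]
    have h1 : ∏ i, ((π c * y i) ^ w i) ^ α i =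
        π c ^ Finsupp.weight v α * ∏ i, y i ^ (sc α) i := by
      rw [Finsupp.weight_eq_sum, ← Finset.prod_pow_eq_pow_sum, ← Finset.prod_mul_distrib]
      refine Finset.prod_congr rfl fun i _ => ?_
      rw [← pow_mul, mul_pow, smul_eq_mul, mul_comm (α i)]
      rfl
    rw [h1, ← Nat.add_sub_cancel' (hsupp α hα), pow_add]
    simp only [Nat.add_sub_cancel_left]
    ring
  have hmem := coeff_mem_of_eval_eq_zero hd y hSq g heval n (fun γ hγ => by
    rw [hgc]
    refine Finset.sum_eq_zero fun α hα => if_neg ?_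
    rintro rfl
    rw [hdeg] at hγ
    exact absurd (hsupp α hα) (not_le.2 hγ)) (sc β) (hdeg β)
  have hβ : β ∈ f.support := MvPolynomial.mem_support_iff.2 hu.ne_zero
  rw [hgc, Finset.sum_eq_single_of_mem β hβ fun α _ h => if_neg fun h' => h (hsc h'), if_pos rfl,
    ← hn, Nat.sub_self, pow_zero, mul_one] at hmem
  exact hq.ne_top (Ideal.eq_top_of_isUnit_mem _ hmem (hu.map π))

/-! ### Assembling the two inequalities -/

/-- Every chain of primes in a quotient ring lives over a minimal prime. -/
theorem exists_mem_minimalPrimes_length_le {R : Type*} [CommRing R] (I : Ideal R)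
    (l : LTSeries (PrimeSpectrum.zeroLocus (I : Set R))) :
    ∃ P ∈ I.minimalPrimes, (l.length : WithBot ℕ∞) ≤ ringKrullDim (R ⧸ P) := by
  obtain ⟨P, hP, hle⟩ := Ideal.exists_minimalPrimes_le (I := I) (J := l.head.1.asIdeal) l.head.2
  refine ⟨P, hP, ?_⟩
  rw [ringKrullDim_quotient]
  let l' : LTSeries (PrimeSpectrum.zeroLocus (P : Set R)) := LTSeries.mk l.length
    (fun i => ⟨(l i).1, fun _ hx => (show l.head.1 ≤ (l i).1 from LTSeries.head_le l i) (hle hx)⟩)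
    fun _ _ hij => l.strictMono hij
  exact Order.le_krullDim_iff.2 ⟨l', rfl⟩

theorem theorem1p9 {R : Type*} [CommRing R] [IsNoetherianRing R] (J : Ideal R)
    (w : ℕ → ℕ) (hw : ∀ i, 0 < w i) :
    (zeroColonInfty J ≠ ⊤ →
      IsLUB ((fun s : ℕ => (s : WithBot ℕ∞)) '' weightedIndependentLengths w J)
        (ringKrullDim (R ⧸ zeroColonInfty J))) ∧
    (zeroColonInfty J = ⊤ → ∀ s ∈ weightedIndependentLengths w J, s = 0) := by
  have hupper : ∀ s ∈ weightedIndependentLengths w J, s ≠ 0 → ∃ P : Ideal R, P.IsPrime ∧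
      zeroColonInfty J ≤ P ∧ (s : WithBot ℕ∞) ≤ ringKrullDim (R ⧸ P) := by
    rintro s ⟨a, haJ, ha⟩ hs
    obtain ⟨P, hP, haP, hle⟩ := ha.exists_isPrime
    let i : Fin s := ⟨0, Nat.pos_of_ne_zero hs⟩
    exact ⟨P, hP, zeroColonInfty_le_of_notMem (haJ i) (haP i), hle⟩
  refine ⟨fun htop => ⟨?_, fun b hb => ?_⟩, fun htop s hs => ?_⟩
  · rintro _ ⟨s, hs, rfl⟩
    dsimp only
    rcases eq_or_ne s 0 with rfl | h0
    · have := Ideal.Quotient.nontrivial_iff.2 htop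
      simpa using ringKrullDim_nonneg_of_nontrivial (R := R ⧸ zeroColonInfty J)
    · obtain ⟨P, -, hKP, hle⟩ := hupper s hs h0
      exact hle.trans (ringKrullDim_le_of_surjective (Ideal.Quotient.factor hKP)
        (Ideal.Quotient.factor_surjective hKP))
  · rw [ringKrullDim_quotient, Order.krullDim]
    refine iSup_le fun l => ?_
    obtain ⟨P, hP, hle⟩ := exists_mem_minimalPrimes_length_le _ l
    have hPprime : P.IsPrime := hP.1.1
    -- The dimension of R/P is the supremum of the heights of its primes, which are finite by
    -- Noetherianity; each is the length of an independent sequence.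
    refine hle.trans ((ringKrullDim_le_iff_height_le b).2 fun q hq => ?_)
    obtain ⟨d, hd⟩ := ENat.ne_top_iff_exists.1 (Ideal.height_ne_top (I := q) hq.ne_top)
    have := hb ⟨d, mem_weightedIndependentLengths_of_height_eq
      (not_le_of_mem_minimalPrimes_zeroColonInfty hP) hw hd.symm, rfl⟩
    rw [← hd]
    exact this
  · by_contra h0
    obtain ⟨P, hP, hKP, -⟩ := hupper s hs h0
    exact hP.ne_top (top_le_iff.1 (htop ▸ hKP))
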